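/- A signed graph $\Gamma=(G,\sigma)$ is a finite simple graph $G$ with a function $\sigma:E(G)\to\{+1,-1\}$. Its adjacency matrix $A(\Gamma)$ has entry $\sigma(uv)$ at $(u,v)$ if $uv\in E(G)$ and $0$ otherwise; its nullity $\eta(\Gamma)$ is the number of zero eigenvalues of $A(\Gamma)$, counted with multiplicity; $p(\Gamma)$ is the number of vertices of degree $1$ of $G$; and $\theta(\Gamma)=|E(G)|-|V(G)|+c(G)$, where $c(G)$ is the number of connected components of $G$. A signed graph is balanced if the product of the edge signs along each of its cycles is $+1$, and unbalanced otherwise. An isomorphism of signed graphs is an isomorphism of the underlying graphs that preserves the signs of the edges. Let $\Gamma$ be a signed graph of order $n$, each connected component of which has at least two vertices. Then $\eta(\Gamma)=p(\Gamma)+2\theta(\Gamma)$ if and only if $\Gamma$ is isomorphic to a disjoint union $C_{n_1}^{\sigma}\cup C_{n_2}^{\sigma}\cup\cdots\cup C_{n_t}^{\sigma}$ of signed cycles, with $n_i\ge 3$ vertices each and $n_1+n_2+\cdots+n_t=n$, such that for every $i\in\{1,\ldots,t\}$, $n_i\equiv 0 \pmod 4$ if $C_{n_i}^{\sigma}$ is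 balanced and $n_i\equiv 2 \pmod 4$ if $C_{n_i}^{\sigma}$ is unbalanced. -/

import Mathlib

/-- A signed graph `Γ = (G, σ)` on the vertex set `V`: a simple graph `G` together with a sign
function on its edges; the signs `+` and `-` are the units `1` and `-1` of `ℤ`. -/
structure SignedGraph (V : Type*) where
  /-- the underlying simple graph -/
  graph : SimpleGraph V
  /-- the sign function `σ : E(G) → {+, -}` -/
  sign : graph.edgeSet → ℤˣ

namespace SignedGraph

/-- The adjacency matrix of a signed graph: the entry at `(u, v)` is the sign of the edge `uv`
if there is one, and `0` otherwise. -/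
noncomputable def adjMatrix {V : Type*} (Γ : SignedGraph V) : Matrix V V ℝ :=
  open Classical in
  Matrix.of fun u v =>
    if h : Γ.graph.Adj u v then (((Γ.sign ⟨s(u, v), h⟩ : ℤˣ) : ℤ) : ℝ) else 0

theorem isHermitian_adjMatrix {V : Type*} (Γ : SignedGraph V) : Γ.adjMatrix.IsHermitian := by
  ext u v
  by_cases h : Γ.graph.Adj u v
  · have h' := h.symm
    have e : (⟨s(v, u), h'⟩ : Γ.graph.edgeSet) = ⟨s(u, v), h⟩ := Subtype.ext Sym2.eq_swap
    simp [adjMatrix, h, h', e]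
  · have h' : ¬ Γ.graph.Adj v u := fun k => h k.symm
    simp [adjMatrix, h, h']

/-- The nullity `η(Γ)`: the number of zero eigenvalues of the adjacency matrix, counted with
multiplicity (`eigenvalues` lists all `|V|` eigenvalues with multiplicity). -/
noncomputable def nullity {V : Type*} [Fintype V] [DecidableEq V] (Γ : SignedGraph V) : ℕ :=
  Nat.card {i : V // Γ.isHermitian_adjMatrix.eigenvalues i = 0}

/-- The number `p(Γ)` of pendant vertices, that is, of vertices of degree `1`. -/
noncomputable def numPendant {V : Type*} (Γ : SignedGraph V) : ℕ :=
  Nat.card {v : V // (Γ.graph.neighborSet v).ncard = 1}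

/-- The cyclomatic number `θ(Γ) = |E| - |V| + c`, where `c` is the number of connected
components. -/
noncomputable def cyclomaticNumber {V : Type*} (Γ : SignedGraph V) : ℤ :=
  (Nat.card Γ.graph.edgeSet : ℤ) - Nat.card V + Nat.card Γ.graph.ConnectedComponent

/-- The sign of a walk: the product of the signs of the edges it traverses. For a cycle, which
traverses each of its edges once, this is the product over the edge set of the cycle. -/
def walkSign {V : Type*} (Γ : SignedGraph V) {u v : V} (w : Γ.graph.Walk u v) : ℤˣ :=
  (w.darts.map fun d => Γ.sign ⟨d.edge, d.edge_mem⟩).prod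

/-- A signed graph is balanced if all of its cycles are positive. -/
def Balanced {V : Type*} (Γ : SignedGraph V) : Prop :=
  ∀ (v : V) (w : Γ.graph.Walk v v), w.IsCycle → Γ.walkSign w = 1

/-- Two signed graphs are isomorphic if some isomorphism of the underlying graphs preserves the
sign of every edge. -/
def Isomorphic {V W : Type*} (Γ : SignedGraph V) (Δ : SignedGraph W) : Prop :=
  ∃ φ : Γ.graph ≃g Δ.graph, ∀ e : Γ.graph.edgeSet, Δ.sign (φ.mapEdgeSet e) = Γ.sign e

/-- The signed cycle `C_n^σ` of length `n` (a cycle for `3 ≤ n`). -/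
def cycle (n : ℕ) (σ : (SimpleGraph.cycleGraph n).edgeSet → ℤˣ) : SignedGraph (Fin n) where
  graph := SimpleGraph.cycleGraph n
  sign := σ

/-- The disjoint union of a family of graphs. -/
def graphUnion {ι : Type*} {V : ι → Type*} (G : ∀ i, SimpleGraph (V i)) :
    SimpleGraph (Σ i, V i) :=
  ⨆ i, (G i).map (Function.Embedding.sigmaMk i)

theorem exists_of_mem_graphUnion {ι : Type*} {V : ι → Type*} {G : ∀ i, SimpleGraph (V i)}
    (e : (graphUnion G).edgeSet) :
    ∃ f : Σ i, (G i).edgeSet, Sym2.map (Sigma.mk f.1) f.2.1 = e.1 := by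
  obtain ⟨e, he⟩ := e
  simp only [graphUnion, SimpleGraph.edgeSet_iSup, Set.mem_iUnion, SimpleGraph.edgeSet_map] at he
  obtain ⟨i, f, hf, rfl⟩ := he
  exact ⟨⟨i, f, hf⟩, rfl⟩

/-- The disjoint union of a family of signed graphs: every edge of the union is the copy of an
edge of exactly one member of the family and keeps its sign. -/
noncomputable def disjUnion {ι : Type*} {V : ι → Type*} (Γ : ∀ i, SignedGraph (V i)) :
    SignedGraph (Σ i, V i) where
  graph := graphUnion fun i => (Γ i).graph
  sign e := (Γ (exists_of_mem_graphUnion e).choose.1).sign (exists_of_mem_graphUnion e).choose.2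

/-- The edge of the union that is the copy of the edge `e` of the `i`-th graph has the sign
of `e`. -/
theorem disjUnion_sign {ι : Type*} {V : ι → Type*} (Γ : ∀ i, SignedGraph (V i)) (i : ι)
    (e : (Γ i).graph.edgeSet) (h : Sym2.map (Sigma.mk i) e.1 ∈ (disjUnion Γ).graph.edgeSet) :
    (disjUnion Γ).sign ⟨Sym2.map (Sigma.mk i) e.1, h⟩ = (Γ i).sign e := by
  have key : ∀ f : Σ j, (Γ j).graph.edgeSet,
      Sym2.map (Sigma.mk f.1) f.2.1 = Sym2.map (Sigma.mk i) e.1 →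
      (Γ f.1).sign f.2 = (Γ i).sign e := by
    rintro ⟨j, f⟩ hf
    have hij : j = i := by
      obtain ⟨f, hf'⟩ := f
      obtain ⟨e, he'⟩ := e
      induction f using Sym2.ind with | _ a b =>
      induction e using Sym2.ind with | _ c d =>
      have : (⟨j, a⟩ : Σ i, V i) ∈ Sym2.map (Sigma.mk i) s(c, d) := by
        rw [← hf]; simp
      simp only [Sym2.map_mk, Sym2.mem_iff] at this
      rcases this with h | h <;> exact congrArg Sigma.fst h
    subst hij
    have : f = e := Subtype.ext (Sym2.map.injective sigma_mk_injective hf)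
    rw [this]
  exact key _ (exists_of_mem_graphUnion (G := fun i => (Γ i).graph)
    ⟨Sym2.map (Sigma.mk i) e.1, h⟩).choose_spec

end SignedGraph

/-! With all degrees positive, the handshake lemma turns `p + 2θ` into `2c + ∑ (deg v - 2)` with
truncated subtraction. The theorem becomes the equality case of an upper bound on the nullity.

The bound comes from zero forcing. Let a kernel vector vanish on `B`, and let `v` have neighbours
outside `B`. Asking it to vanish at all but one of them makes row `v` force the last one. This costs
`|N(v) \ B| - 1` dimensions and enlarges `B`. The total of `forcingCost` pays for every such step,
so it bounds the dimension of the kernel vectors vanishing on `B` (`finrank_kerVanishing_le_sum`).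
Starting from one vertex per component costs `c` for the start and at most `c + ∑ (deg v - 2)` for
the forcing.

The bound is strict if a pendant vertex exists (`finrank_ker_lt_of_degree_eq_one`), or if some
vertex `z` of degree at least 3 lies on a cycle: forcing that reaches `z` from two sides saves one
dimension (`finrank_ker_lt_of_walk_avoiding`). Equality therefore makes the graph 2-regular, a
disjoint union of `t` cycles, and the bound is `2t`.

On a cycle the kernel equation is a two-step recurrence, so each nullity is at most 2 and all must
equal 2. This happens exactly when every solution of the recurrence closes up around the cycle,
which is the condition on length and balance (`nullity_cycle_eq_two_iff`). -/

namespace SimpleGraph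

open Module

/-! ### Zero forcing bounds for kernel vectors. -/

section Kernel

variable {V : Type*} [Fintype V]

/-- The kernel vectors of `A` that vanish on `B`. -/
def kerVanishing (A : Matrix V V ℝ) (B : Finset V) : Submodule ℝ (V → ℝ) where
  carrier := {x | A.mulVec x = 0 ∧ ∀ v ∈ B, x v = 0}
  add_mem' := by
    rintro x y ⟨hx, hx'⟩ ⟨hy, hy'⟩
    refine ⟨by rw [Matrix.mulVec_add, hx, hy, add_zero], fun v hv => ?_⟩
    simp [hx' v hv, hy' v hv]
  zero_mem' := by simp
  smul_mem' := by
    rintro c x ⟨hx, hx'⟩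
    refine ⟨by rw [Matrix.mulVec_smul, hx, smul_zero], fun v hv => ?_⟩
    simp [hx' v hv]

theorem mem_kerVanishing {A : Matrix V V ℝ} {B : Finset V} {x : V → ℝ} :
    x ∈ kerVanishing A B ↔ A.mulVec x = 0 ∧ ∀ v ∈ B, x v = 0 := Iff.rfl

theorem kerVanishing_empty (A : Matrix V V ℝ) :
    kerVanishing A ∅ = LinearMap.ker A.mulVecLin := by
  ext x
  simp [mem_kerVanishing]

variable [DecidableEq V]

/-- Rank-nullity for the restriction of these vectors to the coordinates in `S`. -/
theorem finrank_kerVanishing_le_card_add (A : Matrix V V ℝ) (B S C : Finset V)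
    (h : kerVanishing A (B ∪ S) ≤ kerVanishing A C) :
    finrank ℝ (kerVanishing A B) ≤ S.card + finrank ℝ (kerVanishing A C) := by
  let f : kerVanishing A B →ₗ[ℝ] (S → ℝ) :=
    (LinearMap.funLeft ℝ ℝ (Subtype.val : S → V)).comp (kerVanishing A B).subtype
  have h1 := LinearMap.finrank_range_add_finrank_ker f
  have h2 : finrank ℝ (LinearMap.range f) ≤ S.card := by
    refine (Submodule.finrank_le _).trans ?_
    simp
  have h3 : finrank ℝ (LinearMap.ker f) ≤ finrank ℝ (kerVanishing A C) := by
    let g : LinearMap.ker f →ₗ[ℝ] kerVanishing A C :=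
      ((kerVanishing A B).subtype.comp (LinearMap.ker f).subtype).codRestrict _ (by
        rintro ⟨⟨x, hx, hxB⟩, hf⟩
        refine h ⟨hx, fun v hv => ?_⟩
        rcases Finset.mem_union.1 hv with hv | hv
        · exact hxB v hv
        · exact congrFun hf (⟨v, hv⟩ : S))
    refine LinearMap.finrank_le_finrank_of_injective (f := g) fun x y hxy => ?_
    have hval : (g x : V → ℝ) = g y := congrArg Subtype.val hxy
    exact Subtype.ext (Subtype.ext hval)
  omega

variable (G : SimpleGraph V) [DecidableRel G.Adj]

/-- The cost of the vertex `v` in the bound on the kernel vectors that vanish on `B`. -/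
def forcingCost (B : Finset V) (v : V) : ℕ :=
  if v ∈ B then (G.neighborFinset v \ B).card - 1 else G.degree v - 2

variable {G}

/-- Once all neighbours of `v` but `u` carry the value zero, row `v` reads `A v u * x u = 0`. -/
theorem finrank_kerVanishing_le_forcing
    {A : Matrix V V ℝ} (hA : ∀ v w, A v w ≠ 0 ↔ G.Adj v w) {B : Finset V} {v u : V}
    (hu : u ∉ B) (hvu : G.Adj v u) :
    finrank ℝ (kerVanishing A B) ≤ ((G.neighborFinset v \ B).card - 1) +
      finrank ℝ (kerVanishing A (B ∪ G.neighborFinset v)) := by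
  have hmem : u ∈ G.neighborFinset v \ B := by simp [hu, hvu]
  rw [← Finset.card_erase_of_mem hmem]
  refine finrank_kerVanishing_le_card_add A B _ _ ?_
  rintro x ⟨hx, hx0⟩
  have hzero : ∀ w, w ∈ B ∪ G.neighborFinset v → w ≠ u → x w = 0 := by
    intro w hw hwu
    apply hx0
    simp only [Finset.mem_union, Finset.mem_erase, Finset.mem_sdiff] at hw ⊢
    tauto
  refine ⟨hx, fun w hw => ?_⟩
  by_cases hwu : w = u
  · subst hwu
    have h := congrFun hx v
    rw [Matrix.mulVec, dotProduct, Finset.sum_eq_single w] at h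
    · simpa [(hA v w).2 hvu] using h
    · intro w' _ hne
      by_cases hadj : G.Adj v w'
      · rw [hzero w' (by simp [hadj]) hne, mul_zero]
      · rw [not_not.1 (mt (hA v w').1 hadj), zero_mul]
    · simp
  · exact hzero w hw hwu

/-- A vertex newly absorbed has the neighbour `v` in `B`, hence at most `deg - 1` neighbours
outside. This is why its cost beforehand is set to `deg - 2`. -/
theorem forcingCost_union_le {B : Finset V} {v : V} (hv : v ∈ B) (w : V) :
    forcingCost G (B ∪ G.neighborFinset v) w ≤ forcingCost G B w := by
  unfold forcingCost
  by_cases hw : w ∈ B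
  · have : (G.neighborFinset w \ (B ∪ G.neighborFinset v)).card ≤ (G.neighborFinset w \ B).card :=
      Finset.card_le_card (Finset.sdiff_subset_sdiff le_rfl Finset.subset_union_left)
    simp only [Finset.mem_union, hw, true_or, if_true]
    omega
  · by_cases hw' : G.Adj v w
    · have : (G.neighborFinset w \ (B ∪ G.neighborFinset v)).card < (G.neighborFinset w).card :=
        Finset.card_lt_card (Finset.ssubset_iff_of_subset Finset.sdiff_subset |>.2
          ⟨v, by simp [hw'.symm], by simp [hv]⟩)
      rw [card_neighborFinset_eq_degree] at this
      simp only [Finset.mem_union, hw, mem_neighborFinset, hw', or_true, if_true, if_false]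
      omega
    · simp [hw, hw']

/-- The cost of `v` itself drops to zero, and that drop is the price of the step. -/
theorem sum_forcingCost_union_add_le {B : Finset V} {v : V} (hv : v ∈ B) :
    ∑ w, forcingCost G (B ∪ G.neighborFinset v) w + ((G.neighborFinset v \ B).card - 1) ≤
      ∑ w, forcingCost G B w := by
  rw [← Finset.add_sum_erase _ _ (Finset.mem_univ v),
    ← Finset.add_sum_erase _ (forcingCost G B) (Finset.mem_univ v)]
  have h1 : forcingCost G (B ∪ G.neighborFinset v) v = 0 := by
    have : G.neighborFinset v \ (B ∪ G.neighborFinset v) = ∅ := by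
      rw [Finset.sdiff_eq_empty_iff_subset]; exact Finset.subset_union_right
    simp [forcingCost, hv, this]
  have h2 : forcingCost G B v = (G.neighborFinset v \ B).card - 1 := by simp [forcingCost, hv]
  have h3 := Finset.sum_le_sum
    (fun w (_ : w ∈ Finset.univ.erase v) => forcingCost_union_le (G := G) hv w)
  omega

/-- The vertex `z` loses an outside neighbour that it does not pay for; since it had at least two,
its truncated cost really decreases. -/
theorem sum_forcingCost_union_add_lt {B : Finset V} {v z : V} (hv : v ∈ B) (hz : z ∈ B)
    (hzv : z ≠ v) (h2 : 2 ≤ (G.neighborFinset z \ B).card)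
    (hlt : (G.neighborFinset z \ (B ∪ G.neighborFinset v)).card < (G.neighborFinset z \ B).card) :
    ∑ w, forcingCost G (B ∪ G.neighborFinset v) w + ((G.neighborFinset v \ B).card - 1) + 1 ≤
      ∑ w, forcingCost G B w := by
  rw [← Finset.add_sum_erase _ _ (Finset.mem_univ v),
    ← Finset.add_sum_erase _ (forcingCost G B) (Finset.mem_univ v)]
  have h1 : forcingCost G (B ∪ G.neighborFinset v) v = 0 := by
    have : G.neighborFinset v \ (B ∪ G.neighborFinset v) = ∅ := by
      rw [Finset.sdiff_eq_empty_iff_subset]; exact Finset.subset_union_right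
    simp [forcingCost, hv, this]
  have h2 : forcingCost G B v = (G.neighborFinset v \ B).card - 1 := by simp [forcingCost, hv]
  have h3 := Finset.sum_lt_sum (s := Finset.univ.erase v)
    (fun w _ => forcingCost_union_le (G := G) hv w)
    ⟨z, by simp [hzv], by
      simp only [forcingCost, Finset.mem_union, hz, true_or, if_true]; omega⟩
  omega

theorem card_compl_union_lt {B : Finset V} {v u : V} (hu : u ∉ B) (hvu : G.Adj v u) :
    (B ∪ G.neighborFinset v)ᶜ.card < Bᶜ.card := by
  refine Finset.card_lt_card (Finset.ssubset_iff_of_subset ?_ |>.2 ⟨u, by simp [hu], by simp [hvu]⟩)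
  exact Finset.compl_subset_compl.2 Finset.subset_union_left

theorem finrank_kerVanishing_le_sum
    {A : Matrix V V ℝ} (hA : ∀ v w, A v w ≠ 0 ↔ G.Adj v w) {B : Finset V}
    (hB : ∀ w, ∃ b ∈ B, G.Reachable b w) :
    finrank ℝ (kerVanishing A B) ≤ ∑ w, forcingCost G B w := by
  induction hk : Bᶜ.card using Nat.strong_induction_on generalizing B with
  | _ k ih =>
  by_cases hex : ∃ v ∈ B, ∃ u ∉ B, G.Adj v u
  · obtain ⟨v, hv, u, hu, hvu⟩ := hex
    have h1 := finrank_kerVanishing_le_forcing hA hu hvu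
    have h2 := ih _ (hk ▸ card_compl_union_lt hu hvu) (B := B ∪ G.neighborFinset v)
      (fun w => (hB w).imp fun b hb => ⟨Finset.mem_union_left _ hb.1, hb.2⟩) rfl
    have h3 := sum_forcingCost_union_add_le (G := G) hv
    omega
  · push Not at hex
    -- No edge leaves `B` and `B` meets every component, so the forcing is complete.
    have hall : ∀ w, w ∈ B := by
      intro w
      obtain ⟨b, hb, ⟨p⟩⟩ := hB w
      by_contra hw
      obtain ⟨d, -, hd1, hd2⟩ := p.exists_boundary_dart (B : Set V) hb hw
      exact hex _ hd1 _ hd2 d.adj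
    have : kerVanishing A B = ⊥ := by
      rw [eq_bot_iff]
      rintro x ⟨-, hx⟩
      exact funext fun v => hx v (hall v)
    rw [this, finrank_bot]
    exact Nat.zero_le _

/-- Force only along the walk `p`, which avoids `z`. Before the walk can be exhausted, some vertex
other than `z` absorbs a neighbour of `z`, and one unit of the cost of `z` is saved. -/
theorem finrank_kerVanishing_lt_sum
    {A : Matrix V V ℝ} (hA : ∀ v w, A v w ≠ 0 ↔ G.Adj v w) {B : Finset V}
    (hB : ∀ w, ∃ b ∈ B, G.Reachable b w)
    {z w x : V} (hz : z ∈ B) (hz2 : 2 ≤ (G.neighborFinset z \ B).card) (hw : w ∈ B) (hx : x ∉ B)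
    (hzx : G.Adj z x) (p : G.Walk w x) (hp : z ∉ p.support) :
    finrank ℝ (kerVanishing A B) < ∑ w, forcingCost G B w := by
  induction hk : Bᶜ.card using Nat.strong_induction_on generalizing B with
  | _ k ih =>
  obtain ⟨d, hd, hd1, hd2⟩ := p.exists_boundary_dart (B : Set V) hw hx
  have hdz : z ≠ d.fst := fun h => hp (h ▸ p.dart_fst_mem_support_of_mem_darts hd)
  have hB' : ∀ w, ∃ b ∈ B ∪ G.neighborFinset d.fst, G.Reachable b w :=
    fun w => (hB w).imp fun b hb => ⟨Finset.mem_union_left _ hb.1, hb.2⟩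
  have hsub : G.neighborFinset z \ (B ∪ G.neighborFinset d.fst) ⊆ G.neighborFinset z \ B :=
    Finset.sdiff_subset_sdiff le_rfl Finset.subset_union_left
  have h1 := finrank_kerVanishing_le_forcing hA hd2 d.adj
  -- Either this step absorbs a neighbour of `z`, or `N(z) \ B` is unchanged, `x` is still outside,
  -- and the same walk serves again.
  rcases (Finset.card_le_card hsub).lt_or_eq with hlt | heq
  · have h2 := finrank_kerVanishing_le_sum hA hB'
    have h3 := sum_forcingCost_union_add_lt hd1 hz hdz hz2 hlt
    omega
  · have hset := Finset.eq_of_subset_of_card_le hsub heq.ge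
    have hx' : x ∉ B ∪ G.neighborFinset d.fst := by
      have : x ∈ G.neighborFinset z \ B := by simp [hx, hzx]
      rw [← hset] at this
      exact (Finset.mem_sdiff.1 this).2
    have h2 := ih _ (hk ▸ card_compl_union_lt hd2 d.adj) hB' (Finset.mem_union_left _ hz)
      (by rw [hset]; exact hz2) (Finset.mem_union_left _ hw) hx' rfl
    have h3 := sum_forcingCost_union_add_le (G := G) hd1
    omega

end Kernel

end SimpleGraph

namespace SimpleGraph

open Module

/-! ### Cycles in connected graphs. -/

section Components

variable {V : Type*}

theorem ConnectedComponent.ncard_neighborSet_toSimpleGraph {G : SimpleGraph V}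
    (c : G.ConnectedComponent) (a : c) :
    (c.toSimpleGraph.neighborSet a).ncard = (G.neighborSet (a : V)).ncard := by
  rw [← Set.ncard_image_of_injective _ Subtype.val_injective]
  congr 1
  ext w
  simp only [Set.mem_image, mem_neighborSet]
  constructor
  · rintro ⟨b, hb, rfl⟩
    exact hb
  · intro hw
    exact ⟨⟨w, (c.mem_supp_congr_adj hw).1 a.2⟩, hw, rfl⟩

theorem degree_eq_ncard_neighborSet (G : SimpleGraph V) (v : V) [Fintype (G.neighborSet v)] :
    G.degree v = (G.neighborSet v).ncard := by
  rw [← card_neighborSet_eq_degree, Set.ncard_eq_toFinset_card', Set.toFinset_card]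

/-- An injective homomorphism into a connected graph that does not increase degrees is an
isomorphism. -/
theorem Connected.surjective_and_adj_iff_of_ncard_le {W : Type*} [Finite V] {H : SimpleGraph W}
    {G : SimpleGraph V} [Nonempty W] (hG : G.Connected) (f : W → V) (hf : f.Injective)
    (hadj : ∀ a b, H.Adj a b → G.Adj (f a) (f b))
    (hdeg : ∀ a, (G.neighborSet (f a)).ncard ≤ (H.neighborSet a).ncard) :
    f.Surjective ∧ ∀ a b, H.Adj a b ↔ G.Adj (f a) (f b) := by
  have himage : ∀ a, f '' H.neighborSet a = G.neighborSet (f a) := by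
    intro a
    refine Set.eq_of_subset_of_ncard_le ?_ ?_ (Set.toFinite _)
    · rintro _ ⟨b, hb, rfl⟩
      exact hadj a b hb
    · rw [Set.ncard_image_of_injective _ hf]
      exact hdeg a
  constructor
  · intro v
    by_contra hv
    obtain ⟨a⟩ := ‹Nonempty W›
    obtain ⟨p⟩ := hG.preconnected (f a) v
    obtain ⟨d, -, ⟨b, hb⟩, hd2⟩ := p.exists_boundary_dart (Set.range f) ⟨a, rfl⟩ hv
    have : d.snd ∈ G.neighborSet (f b) := hb ▸ d.adj
    rw [← himage] at this
    obtain ⟨e, -, he⟩ := this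
    exact hd2 ⟨e, he⟩
  · intro a b
    refine ⟨hadj a b, fun h => ?_⟩
    have : f b ∈ G.neighborSet (f a) := h
    rw [← himage] at this
    obtain ⟨e, he, heb⟩ := this
    exact hf heb ▸ he

theorem ncard_neighborSet_cycleGraph {n : ℕ} (hn : 3 ≤ n) (v : Fin n) :
    ((cycleGraph n).neighborSet v).ncard = 2 := by
  obtain ⟨m, rfl⟩ := Nat.exists_eq_add_of_le' hn
  rw [← degree_eq_ncard_neighborSet, cycleGraph_degree_three_le]

/-- A cycle in the graph gives an injective homomorphism from a cycle graph; both sides are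
2-regular, so connectedness makes it an isomorphism. -/
theorem Connected.exists_iso_cycleGraph [Finite V] {G : SimpleGraph V} (hG : G.Connected)
    (h2 : ∀ v, (G.neighborSet v).ncard = 2) : ∃ n, 3 ≤ n ∧ Nonempty (cycleGraph n ≃g G) := by
  obtain ⟨v⟩ := hG.nonempty
  have hcyc : G.IsCycles := fun w _ => h2 w
  obtain ⟨p, hp, -⟩ := hcyc.exists_cycle_toSubgraph_verts_eq_connectedComponentSupp
    (v := v) (c := G.connectedComponentMk v) rfl
    (Set.nonempty_of_ncard_ne_zero (by rw [h2]; decide))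
  have hn := hp.three_le_length
  obtain ⟨f⟩ := (cycleGraph_isContained_iff (n := p.length) (G := G) (by omega)).2 ⟨v, p, hp, rfl⟩
  have : Nonempty (Fin p.length) := ⟨⟨0, by omega⟩⟩
  obtain ⟨hsurj, hiff⟩ := hG.surjective_and_adj_iff_of_ncard_le f f.injective
    (fun a b h => f.toHom.map_adj h)
    (fun a => by rw [h2, ncard_neighborSet_cycleGraph hn])
  exact ⟨p.length, hn, ⟨⟨Equiv.ofBijective f ⟨f.injective, hsurj⟩, (hiff _ _).symm⟩⟩⟩

/-- A finite tree with more than one vertex has a leaf, so there is a cycle. Were all its vertices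
of degree 2, no edge could leave it and `v` would be unreachable. -/
theorem Connected.exists_isCycle_mem_support [Finite V] {G : SimpleGraph V} (hG : G.Connected)
    (h2 : ∀ v, 2 ≤ (G.neighborSet v).ncard) {v : V} (hv : 3 ≤ (G.neighborSet v).ncard) :
    ∃ (z : V) (p : G.Walk z z), p.IsCycle ∧ 3 ≤ (G.neighborSet z).ncard := by
  classical
  have := Fintype.ofFinite V
  have hac : ¬ G.IsAcyclic := by
    intro hac
    have hne : (G.neighborSet v).Nonempty := Set.nonempty_of_ncard_ne_zero (by omega)
    obtain ⟨w, hw⟩ := hne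
    have : Nontrivial V := ⟨v, w, hw.ne⟩
    obtain ⟨x, hx⟩ := IsTree.exists_vert_degree_one_of_nontrivial ⟨hG, hac⟩
    rw [degree_eq_ncard_neighborSet] at hx
    have := h2 x
    omega
  simp only [IsAcyclic, not_forall, not_not] at hac
  obtain ⟨a, p, hp⟩ := hac
  by_contra hcon
  push Not at hcon
  have hsupp : ∀ z ∈ p.support, (G.neighborSet z).ncard ≤ 2 := by
    intro z hz
    have := hcon z (p.rotate z hz) (hp.rotate hz)
    omega
  have hvs : v ∉ p.support := fun h => by
    have := hsupp v h
    omega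
  obtain ⟨q⟩ := hG.preconnected a v
  obtain ⟨d, -, hd1, hd2⟩ := q.exists_boundary_dart {w | w ∈ p.support} p.start_mem_support hvs
  have hset : p.toSubgraph.neighborSet d.fst = G.neighborSet d.fst :=
    Set.eq_of_subset_of_ncard_le (p.toSubgraph.neighborSet_subset _)
      (by rw [hp.ncard_neighborSet_toSubgraph_eq_two hd1]; exact hsupp _ hd1) (Set.toFinite _)
  have : d.snd ∈ p.toSubgraph.neighborSet d.fst := hset ▸ d.adj
  exact hd2 (Walk.mem_support_of_adj_toSubgraph (Subgraph.Adj.symm this))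

/-- Deleting `z` from the cycle leaves a path between the two neighbours of `z` on it. -/
theorem Walk.IsCycle.exists_walk_avoiding {G : SimpleGraph V} {z : V} {p : G.Walk z z}
    (hp : p.IsCycle) : ∃ (u x : V) (q : G.Walk u x),
      G.Adj z u ∧ G.Adj z x ∧ u ≠ x ∧ z ∉ q.support := by
  cases p with
  | nil => exact absurd hp Walk.not_isCycle_nil
  | @cons _ u _ h q =>
    rw [Walk.cons_isCycle_iff] at hp
    obtain ⟨hq, he⟩ := hp
    have hq' := hq.reverse
    rw [← List.mem_reverse, ← Walk.edges_reverse] at he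
    generalize q.reverse = q' at hq' he
    cases q' with
    | nil => exact absurd rfl h.ne
    | @cons _ x _ h' r =>
      rw [Walk.cons_isPath_iff] at hq'
      refine ⟨u, x, r.reverse, h, h', ?_, by simpa using hq'.2⟩
      rintro rfl
      simp at he

theorem exists_walk_avoiding [Finite V] {G : SimpleGraph V}
    (h2 : ∀ v, 2 ≤ (G.neighborSet v).ncard) {v : V} (hv : 3 ≤ (G.neighborSet v).ncard) :
    ∃ (z u x : V) (p : G.Walk u x), 3 ≤ (G.neighborSet z).ncard ∧ G.Adj z u ∧ G.Adj z x ∧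
      u ≠ x ∧ z ∉ p.support := by
  let c := G.connectedComponentMk v
  obtain ⟨z, p, hp, hz⟩ := c.connected_toSimpleGraph.exists_isCycle_mem_support
    (fun a => by rw [c.ncard_neighborSet_toSimpleGraph]; exact h2 _) (v := ⟨v, rfl⟩)
    (by rw [c.ncard_neighborSet_toSimpleGraph]; exact hv)
  rw [c.ncard_neighborSet_toSimpleGraph] at hz
  obtain ⟨u, x, q, hzu, hzx, hux, hq⟩ := hp.exists_walk_avoiding
  refine ⟨z, u, x, q.map c.toSimpleGraph_hom, hz, hzu, hzx, fun h => hux (Subtype.ext h),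
    fun hmem => ?_⟩
  have hmem' : (z : V) ∈ (q.map c.toSimpleGraph_hom).support := hmem
  obtain ⟨y, hy, hyz⟩ := List.mem_map.1 ((Walk.support_map c.toSimpleGraph_hom q) ▸ hmem')
  have hyz' : y = z := Subtype.ext hyz
  exact hq (hyz' ▸ hy)

end Components

/-! ### The nullity bound and its equality case. -/

section Bounds

variable {V : Type*} [Fintype V] {G : SimpleGraph V} [DecidableRel G.Adj]
  {A : Matrix V V ℝ}

/-- Truncation changes `deg v - 2` only at pendant vertices, by one each. -/
theorem sum_degree_sub_two_add (hpos : ∀ v, 0 < G.degree v) :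
    (∑ v, (G.degree v - 2) : ℕ) + 2 * Fintype.card V =
      2 * G.edgeFinset.card + (Finset.univ.filter fun v => G.degree v = 1).card := by
  rw [← sum_degrees_eq_twice_card_edges, Finset.card_filter, ← Finset.sum_add_distrib,
    ← Finset.card_univ, Finset.card_eq_sum_ones, Finset.mul_sum, ← Finset.sum_add_distrib]
  refine Finset.sum_congr rfl fun v _ => ?_
  have := hpos v
  split_ifs <;> omega

variable [DecidableEq V]

theorem finrank_ker_le_card_add (A : Matrix V V ℝ) (B : Finset V) :
    finrank ℝ (LinearMap.ker A.mulVecLin) ≤ B.card + finrank ℝ (kerVanishing A B) := by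
  rw [← kerVanishing_empty]
  exact finrank_kerVanishing_le_card_add A ∅ B B (by simp)

theorem exists_transversal {G : SimpleGraph V} (v : V) : ∃ B : Finset V, v ∈ B ∧
    B.card ≤ Nat.card G.ConnectedComponent ∧ (∀ w, ∃ b ∈ B, G.Reachable b w) ∧
    ∀ b ∈ B, G.Reachable b v → b = v := by
  classical
  have := Fintype.ofFinite G.ConnectedComponent
  -- One representative per component, with the one in the component of `v` replaced by `v`.
  let r : G.ConnectedComponent → V :=
    Function.update Quot.out (G.connectedComponentMk v) v
  have hr : ∀ c, G.connectedComponentMk (r c) = c := by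
    intro c
    by_cases hc : c = G.connectedComponentMk v
    · rw [hc]
      exact congrArg _ (Function.update_self ..)
    · exact (congrArg _ (Function.update_of_ne hc ..)).trans (Quot.out_eq c)
  have hrv : r (G.connectedComponentMk v) = v := Function.update_self ..
  refine ⟨Finset.univ.image r, ?_, ?_, ?_, ?_⟩
  · exact Finset.mem_image.2 ⟨_, Finset.mem_univ _, hrv⟩
  · rw [Nat.card_eq_fintype_card]
    exact Finset.card_image_le
  · intro w
    exact ⟨r (G.connectedComponentMk w), Finset.mem_image_of_mem _ (Finset.mem_univ _),
      ConnectedComponent.exact (hr _)⟩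
  · intro b hb hbv
    obtain ⟨c, -, rfl⟩ := Finset.mem_image.1 hb
    rw [← hrv, ← ConnectedComponent.sound hbv, hr]

theorem forcingCost_le_of_mem {B : Finset V} {v : V} (hv : v ∈ B) :
    forcingCost G B v ≤ G.degree v - 1 := by
  have : (G.neighborFinset v \ B).card ≤ G.degree v := Finset.card_le_card Finset.sdiff_subset
  simp only [forcingCost, hv, if_true]
  omega

theorem forcingCost_le_of_mem_of_adj {B : Finset V} {v u : V} (hv : v ∈ B) (hu : u ∈ B)
    (h : G.Adj v u) : forcingCost G B v ≤ G.degree v - 2 := by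
  have : (G.neighborFinset v \ B).card < G.degree v :=
    Finset.card_lt_card (Finset.ssubset_iff_of_subset Finset.sdiff_subset |>.2
      ⟨u, by simp [h], by simp [hu]⟩)
  simp only [forcingCost, hv, if_true]
  omega

/-- With `v` as the representative of its component, its cost is `deg v - 1 = 0`, one less than the
general allowance `(deg v - 2) + 1`. -/
theorem finrank_ker_lt_of_degree_eq_one (hA : ∀ v w, A v w ≠ 0 ↔ G.Adj v w) {v : V}
    (hv : G.degree v = 1) :
    finrank ℝ (LinearMap.ker A.mulVecLin) <
      2 * Nat.card G.ConnectedComponent + ∑ w, (G.degree w - 2) := by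
  obtain ⟨B, hvB, hcard, hB, -⟩ := exists_transversal (G := G) v
  have h1 := finrank_ker_le_card_add A B
  have h2 := finrank_kerVanishing_le_sum hA hB
  have h3 : ∑ w, forcingCost G B w < ∑ w, ((G.degree w - 2) + if w ∈ B then 1 else 0) := by
    refine Finset.sum_lt_sum (fun w _ => ?_) ⟨v, Finset.mem_univ _, ?_⟩
    · split_ifs with hw
      · have := forcingCost_le_of_mem (G := G) hw
        omega
      · simp [forcingCost, hw]
    · have := forcingCost_le_of_mem (G := G) hvB
      simp only [hvB, if_true]
      omega
  rw [Finset.sum_add_distrib, Finset.sum_boole] at h3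
  simp at h3
  omega

/-- Start from a transversal through `z` enlarged by `u`. The extra vertex costs one, but `z`, now
adjacent to a vertex of the set, costs one less; the walk from `u` to `x` then gives the strict
saving. -/
theorem finrank_ker_lt_of_walk_avoiding (hA : ∀ v w, A v w ≠ 0 ↔ G.Adj v w) {z u x : V}
    (hz : 3 ≤ G.degree z) (hzu : G.Adj z u) (hzx : G.Adj z x) (hux : u ≠ x) (p : G.Walk u x)
    (hp : z ∉ p.support) :
    finrank ℝ (LinearMap.ker A.mulVecLin) <
      2 * Nat.card G.ConnectedComponent + ∑ w, (G.degree w - 2) := by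
  obtain ⟨B, hzB, hcard, hB, hBz⟩ := exists_transversal (G := G) z
  have hnot : ∀ y, G.Adj z y → y ∉ B := fun y hy hyB =>
    hy.ne' (hBz y hyB hy.symm.reachable)
  have h1 := finrank_ker_le_card_add A (insert u B)
  have hdiff : G.neighborFinset z \ insert u B = (G.neighborFinset z).erase u := by
    ext y
    simp only [Finset.mem_sdiff, mem_neighborFinset, Finset.mem_insert, Finset.mem_erase]
    have := hnot y
    tauto
  have h2 := finrank_kerVanishing_lt_sum hA (B := insert u B)
    (fun w => (hB w).imp fun b hb => ⟨Finset.mem_insert_of_mem hb.1, hb.2⟩)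
    (Finset.mem_insert_of_mem hzB)
    (by
      rw [hdiff, Finset.card_erase_of_mem (by simpa using hzu), card_neighborFinset_eq_degree]
      omega)
    (Finset.mem_insert_self u B)
    (by simp only [Finset.mem_insert, not_or]; exact ⟨hux.symm, hnot x hzx⟩) hzx p hp
  have h3 : ∑ w, forcingCost G (insert u B) w ≤
      ∑ w, ((G.degree w - 2) + if w ∈ B.erase z then 1 else 0) := by
    refine Finset.sum_le_sum (fun w _ => ?_)
    by_cases hwu : w = u
    · subst hwu
      have := forcingCost_le_of_mem_of_adj (G := G) (Finset.mem_insert_self w B)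
        (Finset.mem_insert_of_mem hzB) hzu.symm
      omega
    by_cases hwz : w = z
    · subst hwz
      have := forcingCost_le_of_mem_of_adj (G := G) (Finset.mem_insert_of_mem hzB)
        (Finset.mem_insert_self u B) hzu
      omega
    by_cases hwB : w ∈ B
    · have := forcingCost_le_of_mem (G := G) (Finset.mem_insert_of_mem (b := u) hwB)
      simp only [Finset.mem_erase, hwB, hwz, ne_eq, not_false_eq_true, and_self, if_true]
      omega
    · simp [forcingCost, hwu, hwB]
  rw [Finset.sum_add_distrib, Finset.sum_boole] at h3
  simp only [Finset.filter_univ_mem, Nat.cast_id,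
    Finset.card_erase_of_mem hzB] at h3
  have h4 : (insert u B).card = B.card + 1 := Finset.card_insert_of_notMem (hnot u hzu)
  have h5 : 0 < B.card := Finset.card_pos.2 ⟨z, hzB⟩
  omega

theorem degree_eq_two_of_le_finrank_ker (hA : ∀ v w, A v w ≠ 0 ↔ G.Adj v w)
    (hpos : ∀ v, 0 < G.degree v)
    (h : 2 * Nat.card G.ConnectedComponent + ∑ w, (G.degree w - 2) ≤
      finrank ℝ (LinearMap.ker A.mulVecLin)) (v : V) : G.degree v = 2 := by
  have h2 : ∀ w, 2 ≤ G.degree w := by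
    intro w
    have h0 := hpos w
    have h1 : G.degree w ≠ 1 := fun hw =>
      (finrank_ker_lt_of_degree_eq_one hA hw).not_ge h
    omega
  by_contra hv
  have hv3 : 3 ≤ G.degree v := by
    have := h2 v
    omega
  obtain ⟨z, u, x, p, hz, hzu, hzx, hux, hp⟩ := exists_walk_avoiding
    (fun w => (h2 w).trans_eq (degree_eq_ncard_neighborSet G w)) (v := v)
    (hv3.trans_eq (degree_eq_ncard_neighborSet G v))
  rw [← degree_eq_ncard_neighborSet] at hz
  exact (finrank_ker_lt_of_walk_avoiding hA hz hzu hzx hux p hp).not_ge h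

end Bounds

end SimpleGraph

namespace SignedGraph

open Module SimpleGraph

/-! ### Nullity as a kernel dimension. -/

section Nullity

variable {V : Type*}

theorem adjMatrix_apply_of_adj (Γ : SignedGraph V) {u v : V} (h : Γ.graph.Adj u v) :
    Γ.adjMatrix u v = (((Γ.sign ⟨s(u, v), h⟩ : ℤˣ) : ℤ) : ℝ) := by
  simp [adjMatrix, h]

theorem adjMatrix_apply_of_not_adj (Γ : SignedGraph V) {u v : V} (h : ¬ Γ.graph.Adj u v) :
    Γ.adjMatrix u v = 0 := by
  simp [adjMatrix, h]

theorem adjMatrix_ne_zero_iff (Γ : SignedGraph V) (u v : V) :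
    Γ.adjMatrix u v ≠ 0 ↔ Γ.graph.Adj u v := by
  by_cases h : Γ.graph.Adj u v
  · simp [adjMatrix_apply_of_adj, h]
  · simp [adjMatrix_apply_of_not_adj, h]

theorem nullity_eq_finrank [Fintype V] [DecidableEq V] (Γ : SignedGraph V) :
    Γ.nullity = finrank ℝ (LinearMap.ker Γ.adjMatrix.mulVecLin) := by
  have h1 := LinearMap.finrank_range_add_finrank_ker Γ.adjMatrix.mulVecLin
  have h2 : finrank ℝ (LinearMap.range Γ.adjMatrix.mulVecLin) = _ :=
    Γ.isHermitian_adjMatrix.rank_eq_card_non_zero_eigs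
  rw [finrank_fintype_fun_eq_card] at h1
  have h3 := Fintype.card_subtype_compl
    (fun i : V => Γ.isHermitian_adjMatrix.eigenvalues i = 0)
  have h4 := Fintype.card_subtype_le
    (fun i : V => Γ.isHermitian_adjMatrix.eigenvalues i = 0)
  rw [nullity, Nat.card_eq_fintype_card]
  simp only [ne_eq] at h2
  omega

theorem Isomorphic.nullity_eq {W : Type*} [Fintype V] [DecidableEq V] [Fintype W] [DecidableEq W]
    {Γ : SignedGraph V} {Δ : SignedGraph W} (h : Γ.Isomorphic Δ) : Γ.nullity = Δ.nullity := by
  obtain ⟨φ, hφ⟩ := h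
  have hA : Γ.adjMatrix = Δ.adjMatrix.submatrix φ φ := by
    ext u v
    rw [Matrix.submatrix_apply]
    by_cases huv : Γ.graph.Adj u v
    · rw [adjMatrix_apply_of_adj _ huv, adjMatrix_apply_of_adj _ (φ.map_adj_iff.2 huv),
        ← hφ ⟨s(u, v), huv⟩]
      rfl
    · rw [adjMatrix_apply_of_not_adj _ huv,
        adjMatrix_apply_of_not_adj _ (mt φ.map_adj_iff.1 huv)]
  have h1 := LinearMap.finrank_range_add_finrank_ker Γ.adjMatrix.mulVecLin
  have h2 := LinearMap.finrank_range_add_finrank_ker Δ.adjMatrix.mulVecLin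
  have h3 : Γ.adjMatrix.rank = Δ.adjMatrix.rank := by
    rw [hA]
    exact Matrix.rank_submatrix Δ.adjMatrix φ.toEquiv φ.toEquiv
  rw [finrank_fintype_fun_eq_card] at h1 h2
  have h4 := Fintype.card_congr φ.toEquiv
  rw [nullity_eq_finrank, nullity_eq_finrank]
  unfold Matrix.rank at h3
  omega

end Nullity

/-! ### Disjoint unions: nullity, components and recognition. -/

section DisjUnion

variable {ι : Type*} {V : ι → Type*}

theorem graphUnion_adj {G : ∀ i, SimpleGraph (V i)} {x y : Σ i, V i} :
    (graphUnion G).Adj x y ↔ ∃ i a b, (G i).Adj a b ∧ x = ⟨i, a⟩ ∧ y = ⟨i, b⟩ := by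
  simp only [graphUnion, iSup_adj, map_adj, Function.Embedding.sigmaMk_apply]
  constructor
  · rintro ⟨i, a, b, h, rfl, rfl⟩
    exact ⟨i, a, b, h, rfl, rfl⟩
  · rintro ⟨i, a, b, h, rfl, rfl⟩
    exact ⟨i, a, b, h, rfl, rfl⟩

theorem graphUnion_adj_mk {G : ∀ i, SimpleGraph (V i)} {i : ι} {a b : V i} :
    (graphUnion G).Adj ⟨i, a⟩ ⟨i, b⟩ ↔ (G i).Adj a b := by
  rw [graphUnion_adj]
  constructor
  · rintro ⟨j, a', b', h, h1, h2⟩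
    obtain rfl : i = j := congrArg Sigma.fst h1
    rw [sigma_mk_injective h1, sigma_mk_injective h2]
    exact h
  · exact fun h => ⟨i, a, b, h, rfl, rfl⟩

theorem adjMatrix_disjUnion [DecidableEq ι] (Γ : ∀ i, SignedGraph (V i)) :
    (disjUnion Γ).adjMatrix = Matrix.blockDiagonal' fun i => (Γ i).adjMatrix := by
  ext ⟨i, a⟩ ⟨j, b⟩
  by_cases hij : i = j
  · subst hij
    rw [Matrix.blockDiagonal'_apply_eq]
    by_cases h : (Γ i).graph.Adj a b
    · have h' : (disjUnion Γ).graph.Adj ⟨i, a⟩ ⟨i, b⟩ := graphUnion_adj_mk.2 h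
      rw [adjMatrix_apply_of_adj _ h, adjMatrix_apply_of_adj _ h',
        ← disjUnion_sign Γ i ⟨s(a, b), h⟩ h']
      rfl
    · rw [adjMatrix_apply_of_not_adj _ h,
        adjMatrix_apply_of_not_adj _ (mt graphUnion_adj_mk.1 h)]
  · rw [Matrix.blockDiagonal'_apply_ne _ _ _ hij, adjMatrix_apply_of_not_adj]
    intro h
    obtain ⟨k, a', b', -, h1, h2⟩ := graphUnion_adj.1 h
    exact hij ((congrArg Sigma.fst h1).trans (congrArg Sigma.fst h2).symm)

theorem nullity_disjUnion [Fintype ι] [DecidableEq ι] [∀ i, Fintype (V i)]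
    [∀ i, DecidableEq (V i)] (Γ : ∀ i, SignedGraph (V i)) :
    (disjUnion Γ).nullity = ∑ i, (Γ i).nullity := by
  have hmul : ∀ (x : (Σ i, V i) → ℝ) (i : ι) (a : V i),
      (disjUnion Γ).adjMatrix.mulVec x ⟨i, a⟩ =
        (Γ i).adjMatrix.mulVec (fun b => x ⟨i, b⟩) a := by
    intro x i a
    rw [adjMatrix_disjUnion, Matrix.mulVec, dotProduct, Fintype.sum_sigma, Finset.sum_eq_single i]
    · simp [Matrix.mulVec, dotProduct, Matrix.blockDiagonal'_apply_eq]
    · intro j _ hj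
      exact Finset.sum_eq_zero fun b _ => by
        rw [Matrix.blockDiagonal'_apply_ne _ _ _ hj.symm, zero_mul]
    · simp
  let e : LinearMap.ker (disjUnion Γ).adjMatrix.mulVecLin ≃ₗ[ℝ]
      ∀ i, LinearMap.ker (Γ i).adjMatrix.mulVecLin :=
    { toFun := fun x i => ⟨fun b => x.1 ⟨i, b⟩, by
        ext a
        exact (hmul x.1 i a).symm.trans (congrFun x.2 ⟨i, a⟩)⟩
      invFun := fun y => ⟨fun z => (y z.1).1 z.2, by
        ext ⟨i, a⟩
        exact (hmul _ i a).trans (congrFun (y i).2 a)⟩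
      map_add' := fun _ _ => rfl
      map_smul' := fun _ _ => rfl
      left_inv := fun _ => rfl
      right_inv := fun _ => rfl }
  rw [nullity_eq_finrank, e.finrank_eq, finrank_pi_fintype]
  exact Finset.sum_congr rfl fun i _ => (nullity_eq_finrank _).symm

theorem reachable_graphUnion {G : ∀ i, SimpleGraph (V i)} (i : ι) {a b : V i}
    (h : (G i).Reachable a b) : (graphUnion G).Reachable ⟨i, a⟩ ⟨i, b⟩ :=
  h.map (⟨Sigma.mk i, fun h => graphUnion_adj_mk.2 h⟩ : G i →g graphUnion G)

theorem fst_eq_of_reachable_graphUnion {G : ∀ i, SimpleGraph (V i)} {x y : Σ i, V i}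
    (h : (graphUnion G).Reachable x y) : x.1 = y.1 := by
  obtain ⟨p⟩ := h
  induction p with
  | nil => rfl
  | cons h _ ih =>
    obtain ⟨i, a, b, -, rfl, rfl⟩ := graphUnion_adj.1 h
    exact ih

/-- The components of a disjoint union of connected graphs are the members of the family. -/
theorem card_connectedComponent_graphUnion {G : ∀ i, SimpleGraph (V i)}
    (hG : ∀ i, (G i).Connected) : Nat.card (graphUnion G).ConnectedComponent = Nat.card ι := by
  have hne : ∀ i, Nonempty (V i) := fun i => (hG i).nonempty
  refine (Nat.card_eq_of_bijective
    (fun i => (graphUnion G).connectedComponentMk ⟨i, Classical.arbitrary (V i)⟩) ⟨?_, ?_⟩).symm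
  · intro i j hij
    exact fst_eq_of_reachable_graphUnion (ConnectedComponent.exact hij)
  · intro c
    induction c using ConnectedComponent.ind with | _ v =>
    obtain ⟨i, a⟩ := v
    exact ⟨i, ConnectedComponent.sound (reachable_graphUnion i ((hG i).preconnected _ _))⟩

theorem ncard_neighborSet_graphUnion (G : ∀ i, SimpleGraph (V i)) (i : ι) (a : V i) :
    ((graphUnion G).neighborSet ⟨i, a⟩).ncard = ((G i).neighborSet a).ncard := by
  rw [← Set.ncard_image_of_injective _ (sigma_mk_injective (i := i))]
  congr 1
  ext x
  simp only [mem_neighborSet, Set.mem_image]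
  constructor
  · intro h
    obtain ⟨j, a', b, h', h1, rfl⟩ := graphUnion_adj.1 h
    obtain rfl : i = j := congrArg Sigma.fst h1
    exact ⟨b, (sigma_mk_injective h1) ▸ h', rfl⟩
  · rintro ⟨b, hb, rfl⟩
    exact graphUnion_adj_mk.2 hb

theorem exists_isomorphic_disjUnion {W : Type*} (Γ : SignedGraph W) (G : ∀ i, SimpleGraph (V i))
    (φ : Γ.graph ≃g graphUnion G) :
    ∃ σ : ∀ i, (G i).edgeSet → ℤˣ, Γ.Isomorphic (disjUnion fun i => ⟨G i, σ i⟩) := by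
  have hmem : ∀ (i : ι) (e : (G i).edgeSet),
      Sym2.map (Sigma.mk i) e.1 ∈ (graphUnion G).edgeSet := by
    rintro i ⟨e, he⟩
    induction e using Sym2.ind with | _ a b =>
    exact graphUnion_adj_mk.2 he
  let Δ : ∀ i, SignedGraph (V i) :=
    fun i => ⟨G i, fun e => Γ.sign (φ.symm.mapEdgeSet ⟨_, hmem i e⟩)⟩
  -- Edges are compared through their underlying pairs, so that membership proofs do not obstruct
  -- rewriting.
  have hsign : ∀ (i : ι) (f : (G i).edgeSet) (e : Γ.graph.edgeSet)
      (e' : (disjUnion Δ).graph.edgeSet), e'.1 = Sym2.map (Sigma.mk i) f.1 →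
      e.1 = Sym2.map φ.symm (Sym2.map (Sigma.mk i) f.1) → (disjUnion Δ).sign e' = Γ.sign e := by
    rintro i f ⟨e, he⟩ ⟨e', he'⟩ rfl rfl
    exact disjUnion_sign Δ i f he'
  refine ⟨fun i => (Δ i).sign, φ, fun e => ?_⟩
  obtain ⟨f, hf⟩ := exists_of_mem_graphUnion (φ.mapEdgeSet e)
  refine hsign f.1 f.2 e _ hf.symm ?_
  rw [hf]
  obtain ⟨e, he⟩ := e
  induction e using Sym2.ind with | _ a b =>
  change s(a, b) = s(φ.symm (φ a), φ.symm (φ b))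
  rw [φ.symm_apply_apply, φ.symm_apply_apply]

/-- A graph all of whose components are cycles is a disjoint union of cycle graphs. -/
theorem exists_iso_graphUnion_cycleGraph {W : Type*} [Finite W] (G : SimpleGraph W)
    (h2 : ∀ v, (G.neighborSet v).ncard = 2) :
    ∃ (t : ℕ) (n : Fin t → ℕ), (∀ i, 3 ≤ n i) ∧
      Nonempty (G ≃g graphUnion fun i => SimpleGraph.cycleGraph (n i)) := by
  have hc : ∀ c : G.ConnectedComponent,
      ∃ n, 3 ≤ n ∧ Nonempty (SimpleGraph.cycleGraph n ≃g c.toSimpleGraph) := fun c =>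
    c.connected_toSimpleGraph.exists_iso_cycleGraph
      fun a => by rw [c.ncard_neighborSet_toSimpleGraph, h2]
  choose n hn ψ using hc
  obtain ⟨t, ⟨e⟩⟩ := Finite.exists_equiv_fin G.ConnectedComponent
  let f : (Σ i : Fin t, Fin (n (e.symm i))) → W :=
    fun x => ((ψ (e.symm x.1)).some x.2 : e.symm x.1)
  have hf : ∀ x, G.connectedComponentMk (f x) = e.symm x.1 :=
    fun x => ((ψ (e.symm x.1)).some x.2).2
  have hfi : f.Injective := by
    rintro ⟨i, a⟩ ⟨j, b⟩ hab
    obtain rfl : i = j := e.symm.injective ((hf _).symm.trans ((congrArg _ hab).trans (hf _)))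
    exact congrArg _ ((ψ (e.symm i)).some.injective (Subtype.ext hab))
  have hfs : f.Surjective := by
    intro w
    obtain ⟨i, hi⟩ := e.symm.surjective (G.connectedComponentMk w)
    obtain ⟨a, ha⟩ := (ψ (e.symm i)).some.surjective ⟨w, hi.symm⟩
    exact ⟨⟨i, a⟩, congrArg Subtype.val ha⟩
  have hadj : ∀ x y, G.Adj (f x) (f y) ↔
      (graphUnion fun i => SimpleGraph.cycleGraph (n (e.symm i))).Adj x y := by
    rintro ⟨i, a⟩ ⟨j, b⟩
    by_cases hij : i = j
    · subst hij
      rw [graphUnion_adj_mk]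
      exact (ψ (e.symm i)).some.map_adj_iff
    · refine iff_of_false (fun h => hij ?_) fun h => hij ?_
      · exact e.symm.injective ((hf ⟨i, a⟩).symm.trans
          ((ConnectedComponent.sound h.reachable).trans (hf ⟨j, b⟩)))
      · exact fst_eq_of_reachable_graphUnion h.reachable
  exact ⟨t, fun i => n (e.symm i), fun i => hn _,
    ⟨(⟨Equiv.ofBijective f ⟨hfi, hfs⟩, hadj _ _⟩ : _ ≃g G).symm⟩⟩

end DisjUnion

end SignedGraph

/-! ### Balance and nullity of signed cycles. -/

namespace SignedGraph

open Module SimpleGraph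
open scoped Fin.NatCast

theorem walkSign_cons {V : Type*} (Γ : SignedGraph V) {u v w : V} (h : Γ.graph.Adj u v)
    (p : Γ.graph.Walk v w) :
    Γ.walkSign (Walk.cons h p) = Γ.sign ⟨s(u, v), h⟩ * Γ.walkSign p := by
  simp only [walkSign, Walk.darts_cons, List.map_cons, List.prod_cons]
  rfl

/-- Each inner vertex contributes `f x * f x = 1`, so the product telescopes. -/
theorem walkSign_eq_mul {V : Type*} {Γ : SignedGraph V} (f : V → ℤˣ) {u v : V}
    (w : Γ.graph.Walk u v)
    (h : ∀ d ∈ w.darts, Γ.sign ⟨d.edge, d.edge_mem⟩ = f d.fst * f d.snd) :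
    Γ.walkSign w = f u * f v := by
  induction w with
  | nil => simp [walkSign, Int.units_mul_self]
  | @cons u x v hux p ih =>
    have ih' := ih fun d hd => h d (List.mem_cons_of_mem _ hd)
    have h0 := h ⟨(u, x), hux⟩ List.mem_cons_self
    change Γ.sign ⟨s(u, x), hux⟩ = f u * f x at h0
    rw [walkSign_cons, ih', h0, mul_assoc, ← mul_assoc (f x), Int.units_mul_self, one_mul]

theorem recurrence_even {t Y : ℕ → ℝ} (hY : ∀ k, Y (k + 2) = -(t k * t (k + 1) * Y k)) (m : ℕ) :
    Y (2 * m) = (-1) ^ m * (∏ j ∈ Finset.range (2 * m), t j) * Y 0 := by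
  induction m with
  | zero => simp
  | succ m ih =>
    rw [show 2 * (m + 1) = 2 * m + 1 + 1 by ring, Finset.prod_range_succ, Finset.prod_range_succ,
      hY, ih]
    ring

theorem recurrence_odd {t Y : ℕ → ℝ} (hY : ∀ k, Y (k + 2) = -(t k * t (k + 1) * Y k)) (m : ℕ) :
    Y (2 * m + 1) = (-1) ^ m * (∏ j ∈ Finset.range (2 * m), t (j + 1)) * Y 1 :=
  recurrence_even (t := fun k => t (k + 1)) (Y := fun k => Y (k + 1)) (fun k => hY (k + 1)) m

/-- The solution with initial values `a`, `b` of the recurrence that the kernel vectors of a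
signed cycle satisfy. -/
def recurrenceSolution (t : ℕ → ℝ) (a b : ℝ) : ℕ → ℝ
  | 0 => a
  | 1 => b
  | k + 2 => -(t k * t (k + 1) * recurrenceSolution t a b k)

section Cycle

variable {m : ℕ} (σ : (SimpleGraph.cycleGraph (m + 3)).edgeSet → ℤˣ)

theorem cycleGraph_adj_add_one (i : Fin (m + 3)) :
    (SimpleGraph.cycleGraph (m + 3)).Adj i (i + 1) := by
  simp [SimpleGraph.cycleGraph_adj]

/-- The sign of the edge from `i` to `i + 1` of a signed cycle. -/
def cycleSign (i : Fin (m + 3)) : ℤˣ := σ ⟨s(i, i + 1), cycleGraph_adj_add_one i⟩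

/-- The product of the signs of the edges from `j` to `j + 1` for `j < k`. -/
def cyclePotential (k : ℕ) : ℤˣ := ∏ j ∈ Finset.range k, cycleSign σ (j : Fin (m + 3))

theorem cyclePotential_succ_mul (k : ℕ) :
    cyclePotential σ k * cyclePotential σ (k + 1) = cycleSign σ (k : Fin (m + 3)) := by
  rw [cyclePotential, cyclePotential, Finset.prod_range_succ, ← mul_assoc, Int.units_mul_self,
    one_mul]

theorem cyclePotential_card : cyclePotential σ (m + 3) = ∏ i, cycleSign σ i := by
  rw [cyclePotential, Finset.prod_range]
  simp

theorem sign_eq_cyclePotential_mul {d : (SimpleGraph.cycleGraph (m + 3)).Dart}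
    (h : (SimpleGraph.pathGraph (m + 3)).Adj d.fst d.snd) :
    σ ⟨d.edge, d.edge_mem⟩ = cyclePotential σ d.fst * cyclePotential σ d.snd := by
  have key : ∀ (i j : Fin (m + 3)) (hij : (SimpleGraph.cycleGraph (m + 3)).Adj i j),
      i.val + 1 = j.val →
      σ ⟨s(i, j), hij⟩ = cyclePotential σ i * cyclePotential σ j := by
    intro i j hij h
    have hj : j = i + 1 := by
      apply Fin.ext
      rw [Fin.val_add_one_of_lt' (by omega), h]
    rw [← h, cyclePotential_succ_mul, Fin.cast_val_eq_self]
    subst hj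
    rfl
  obtain ⟨⟨i, j⟩, hij⟩ := d
  rcases SimpleGraph.pathGraph_adj.1 h with h | h
  · exact key i j hij h
  · have := key j i hij.symm h
    rw [mul_comm]
    refine Eq.trans ?_ this
    exact congrArg σ (Subtype.ext Sym2.eq_swap)

/-- The potential explains the signs of all edges except the one from the last vertex to `0`, which
it explains exactly when the total product is 1. Then closed walks telescope to 1; conversely the
path from `0` to the last vertex, closed by that edge, is a cycle whose sign is the total product.
-/
theorem balanced_cycle_iff : (cycle (m + 3) σ).Balanced ↔ ∏ i, cycleSign σ i = 1 := by
  have hlast : (Fin.last (m + 2)) + 1 = 0 := by simp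
  have hadj : (cycle (m + 3) σ).graph.Adj (Fin.last (m + 2)) 0 :=
    hlast ▸ cycleGraph_adj_add_one (Fin.last (m + 2))
  have hsign : (cycle (m + 3) σ).sign ⟨s(Fin.last (m + 2), 0), hadj⟩ =
      cyclePotential σ (m + 2) * ∏ i, cycleSign σ i := by
    rw [← cyclePotential_card, cyclePotential_succ_mul, cycleSign]
    refine congrArg σ (Subtype.ext ?_)
    change s(Fin.last (m + 2), 0) = s(_, _)
    rw [Fin.natCast_eq_last, hlast]
  constructor
  · intro hbal
    obtain ⟨q, hq⟩ := (SimpleGraph.pathGraph_connected (m + 2)).exists_isPath 0 (Fin.last (m + 2))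
    let p : (cycle (m + 3) σ).graph.Walk 0 (Fin.last (m + 2)) :=
      q.mapLe SimpleGraph.pathGraph_le_cycleGraph
    have hedges : p.edges = q.edges := Walk.edges_mapLe_eq_edges ..
    have hcycle : (Walk.cons (G := (cycle (m + 3) σ).graph) hadj p).IsCycle := by
      rw [Walk.cons_isCycle_iff]
      refine ⟨hq.mapLe _, fun he => ?_⟩
      rw [hedges] at he
      have := SimpleGraph.pathGraph_adj.1 (q.adj_of_mem_edges he)
      simp at this
    have h1 := hbal _ _ hcycle
    have h2 : (cycle (m + 3) σ).walkSign p = cyclePotential σ (0 : Fin (m + 3)) *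
        cyclePotential σ (Fin.last (m + 2)) := by
      refine walkSign_eq_mul (fun i : Fin (m + 3) => cyclePotential σ i) p fun d hd => ?_
      refine sign_eq_cyclePotential_mul σ (q.adj_of_mem_edges (hedges ▸ ?_))
      exact List.mem_map_of_mem hd
    rw [walkSign_cons, h2, hsign] at h1
    have h0 : cyclePotential σ ((0 : Fin (m + 3)) : ℕ) = 1 := by simp [cyclePotential]
    rwa [h0, Fin.val_last, one_mul, mul_right_comm, Int.units_mul_self, one_mul] at h1
  · intro hprod v w _
    rw [walkSign_eq_mul (fun i : Fin (m + 3) => cyclePotential σ i) w, Int.units_mul_self]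
    rintro ⟨⟨i, j⟩, hij⟩ -
    by_cases hp : (SimpleGraph.pathGraph (m + 3)).Adj i j
    · exact sign_eq_cyclePotential_mul σ hp
    · have hwrap : ∀ (i j : Fin (m + 3)) (hij : (SimpleGraph.cycleGraph (m + 3)).Adj i j),
          j = i + 1 → ¬ (SimpleGraph.pathGraph (m + 3)).Adj i j →
          σ ⟨s(i, j), hij⟩ = cyclePotential σ i * cyclePotential σ j := by
        rintro i j hij rfl hp
        -- The only edge from `i` to `i + 1` outside the path graph is the closing one.
        have hi : i = Fin.last (m + 2) := by
          by_contra hi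
          refine hp (SimpleGraph.pathGraph_adj.2 (Or.inl ?_))
          rw [Fin.val_add_one_of_lt (Fin.lt_last_iff_ne_last.2 hi)]
        subst hi
        have : σ ⟨s(Fin.last (m + 2), Fin.last (m + 2) + 1), hij⟩ =
            (cycle (m + 3) σ).sign ⟨s(Fin.last (m + 2), 0), hadj⟩ := by
          refine congrArg σ (Subtype.ext ?_)
          change s(_, _) = s(_, _)
          rw [hlast]
        rw [this, hsign, hprod]
        simp [cyclePotential]
      rcases SimpleGraph.cycleGraph_adj.1 hij with h | h
      · have := hwrap j i hij.symm (sub_eq_iff_eq_add'.1 h) (fun h => hp h.symm)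
        refine Eq.trans (congrArg σ (Subtype.ext ?_)) (this.trans (mul_comm _ _))
        exact Sym2.eq_swap
      · exact hwrap i j hij (sub_eq_iff_eq_add'.1 h) hp

theorem mulVec_adjMatrix_cycle (x : Fin (m + 3) → ℝ) (i : Fin (m + 3)) :
    (cycle (m + 3) σ).adjMatrix.mulVec x (i + 1) =
      ((cycleSign σ i : ℤ) : ℝ) * x i + ((cycleSign σ (i + 1) : ℤ) : ℝ) * x (i + 2) := by
  have h2 : i + 1 + 1 = i + 2 := by rw [add_assoc]; rfl
  -- The two neighbours of `i + 1` are distinct because the length is at least 3.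
  have hne : i ≠ i + 2 := by
    intro h
    have : (2 : Fin (m + 3)) = 0 := by simpa using h.symm
    simp [Fin.ext_iff, Nat.mod_eq_of_lt (show 2 < m + 3 by omega)] at this
  have hadj1 : (cycle (m + 3) σ).graph.Adj (i + 1) i := (cycleGraph_adj_add_one i).symm
  have hadj2 : (cycle (m + 3) σ).graph.Adj (i + 1) (i + 2) :=
    h2 ▸ cycleGraph_adj_add_one (i + 1)
  rw [Matrix.mulVec, dotProduct, ← Finset.sum_subset (Finset.subset_univ {i, i + 2}),
    Finset.sum_pair hne]
  · rw [adjMatrix_apply_of_adj (cycle (m + 3) σ) hadj1,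
      adjMatrix_apply_of_adj (cycle (m + 3) σ) hadj2]
    congr 4
    · exact congrArg σ (Subtype.ext Sym2.eq_swap)
    · refine congrArg σ (Subtype.ext ?_)
      change s(i + 1, i + 2) = s(i + 1, i + 1 + 1)
      rw [h2]
  · intro w _ hw
    rw [adjMatrix_apply_of_not_adj, zero_mul]
    intro h
    simp only [Finset.mem_insert, Finset.mem_singleton, not_or] at hw
    rcases SimpleGraph.cycleGraph_adj.1 h with h | h
    · exact hw.1 (add_right_cancel (sub_eq_iff_eq_add'.1 h)).symm
    · exact hw.2 ((sub_eq_iff_eq_add'.1 h).trans h2)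

/-- The signs of the edges of a signed cycle as a periodic sequence of reals. -/
def cycleSignSeq (k : ℕ) : ℝ := ((cycleSign σ (k : Fin (m + 3)) : ℤ) : ℝ)

theorem cycleSignSeq_mul_self (k : ℕ) : cycleSignSeq σ k * cycleSignSeq σ k = 1 := by
  unfold cycleSignSeq
  rw [← Int.cast_mul, ← Units.val_mul, Int.units_mul_self]
  simp

theorem cycleSignSeq_ne_zero (k : ℕ) : cycleSignSeq σ k ≠ 0 := by
  have := cycleSignSeq_mul_self σ k
  rintro h
  simp [h] at this

/-- Row `k + 1` has two nonzero entries, and signs are their own inverses, so the row can be solved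
for `x (k + 2)`. Natural number indices let the recurrence run past the end of the cycle. -/
theorem mem_ker_adjMatrix_cycle_iff (x : Fin (m + 3) → ℝ) :
    (cycle (m + 3) σ).adjMatrix.mulVec x = 0 ↔ ∀ k : ℕ,
      x ((k + 2 : ℕ) : Fin (m + 3)) =
        -(cycleSignSeq σ k * cycleSignSeq σ (k + 1) * x (k : Fin (m + 3))) := by
  have hrow : ∀ k : ℕ, (cycle (m + 3) σ).adjMatrix.mulVec x ((k : Fin (m + 3)) + 1) =
      cycleSignSeq σ k * x (k : Fin (m + 3)) +
        cycleSignSeq σ (k + 1) * x ((k + 2 : ℕ) : Fin (m + 3)) := by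
    intro k
    rw [mulVec_adjMatrix_cycle]
    simp [cycleSignSeq]
  have hiff : ∀ k : ℕ, (cycle (m + 3) σ).adjMatrix.mulVec x ((k : Fin (m + 3)) + 1) = 0 ↔
      x ((k + 2 : ℕ) : Fin (m + 3)) =
        -(cycleSignSeq σ k * cycleSignSeq σ (k + 1) * x (k : Fin (m + 3))) := by
    intro k
    rw [hrow]
    have h1 := cycleSignSeq_mul_self σ (k + 1)
    constructor
    · intro h
      linear_combination cycleSignSeq σ (k + 1) * h - x ((k + 2 : ℕ) : Fin (m + 3)) * h1
    · intro h
      rw [h]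
      linear_combination (-cycleSignSeq σ k * x (k : Fin (m + 3))) * h1
  constructor
  · intro h k
    exact (hiff k).1 (congrFun h _)
  · intro h
    ext i
    have := (hiff (i - 1 : Fin (m + 3)).val).2 (h _)
    rwa [Fin.cast_val_eq_self, sub_add_cancel] at this

theorem kerVanishing_cycle : kerVanishing (cycle (m + 3) σ).adjMatrix {0, 1} = ⊥ := by
  rw [eq_bot_iff]
  rintro x ⟨hx, hx0⟩
  rw [mem_ker_adjMatrix_cycle_iff] at hx
  have key : ∀ k : ℕ, x (k : Fin (m + 3)) = 0 ∧ x ((k + 1 : ℕ) : Fin (m + 3)) = 0 := by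
    intro k
    induction k with
    | zero => exact ⟨by simpa using hx0 0 (by simp), by simpa using hx0 1 (by simp)⟩
    | succ k ih => exact ⟨ih.2, by rw [hx, ih.1, mul_zero, neg_zero]⟩
  ext i
  simpa using (key i.val).1

theorem nullity_cycle_le_two : (cycle (m + 3) σ).nullity ≤ 2 := by
  rw [nullity_eq_finrank]
  have := finrank_ker_le_card_add (cycle (m + 3) σ).adjMatrix {0, 1}
  rw [kerVanishing_cycle, finrank_bot] at this
  exact this.trans (Finset.card_le_two)

theorem prod_cycleSignSeq :
    ∏ j ∈ Finset.range (m + 3), cycleSignSeq σ j = (((∏ i, cycleSign σ i : ℤˣ) : ℤ) : ℝ) := by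
  rw [← cyclePotential_card, cyclePotential]
  simp [cycleSignSeq]

/-- Nullity 2 leaves a kernel vector with `x 1 = 0` and `x 0 ≠ 0`. Going once around must return `x
0`: an odd length would return a multiple of `x 1`, and an even one multiplies `x 0` by `(-1) ^ l`
times the product of signs. -/
theorem exists_of_two_le_nullity_cycle (h : 2 ≤ (cycle (m + 3) σ).nullity) :
    ∃ l, m + 3 = 2 * l ∧ (-1) ^ l * (((∏ i, cycleSign σ i : ℤˣ) : ℤ) : ℝ) = 1 := by
  rw [nullity_eq_finrank] at h
  have h1 := finrank_ker_le_card_add (cycle (m + 3) σ).adjMatrix {1}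
  rw [Finset.card_singleton] at h1
  have h2 : kerVanishing (cycle (m + 3) σ).adjMatrix {1} ≠ ⊥ := by
    intro hbot
    rw [hbot, finrank_bot] at h1
    omega
  obtain ⟨x, ⟨hx, hx1⟩, hne⟩ := Submodule.exists_mem_ne_zero_of_ne_bot h2
  have hx1 : x 1 = 0 := hx1 1 (by simp)
  have hx0 : x 0 ≠ 0 := by
    intro h0
    have : x ∈ kerVanishing (cycle (m + 3) σ).adjMatrix {0, 1} := ⟨hx, by simp [h0, hx1]⟩
    rw [kerVanishing_cycle] at this
    exact hne this
  rw [mem_ker_adjMatrix_cycle_iff] at hx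
  let Y : ℕ → ℝ := fun k => x (k : Fin (m + 3))
  have hY : ∀ k, Y (k + 2) = -(cycleSignSeq σ k * cycleSignSeq σ (k + 1) * Y k) := hx
  have hY0 : Y 0 = x 0 := by simp [Y]
  have hY1 : Y 1 = 0 := by simp [Y, hx1]
  have hYn : Y (m + 3) = x 0 := by simp [Y]
  rcases Nat.even_or_odd' (m + 3) with ⟨l, hl | hl⟩
  · refine ⟨l, hl, ?_⟩
    have := recurrence_even hY l
    rw [← hl, hYn, hY0, prod_cycleSignSeq] at this
    exact mul_right_cancel₀ hx0 (by rw [← this, one_mul])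
  · have := recurrence_odd hY l
    rw [← hl, hYn, hY1, mul_zero] at this
    exact absurd this hx0

theorem cycleSignSeq_add (k : ℕ) : cycleSignSeq σ (k + (m + 3)) = cycleSignSeq σ k := by
  simp [cycleSignSeq]

/-- The hypothesis makes every solution of the recurrence periodic, so the values at `0` and `1` can
be prescribed freely. -/
theorem two_le_nullity_cycle {l : ℕ} (hl : m + 3 = 2 * l)
    (h : (-1) ^ l * (((∏ i, cycleSign σ i : ℤˣ) : ℤ) : ℝ) = 1) :
    2 ≤ (cycle (m + 3) σ).nullity := by
  have hP : (-1) ^ l * ∏ j ∈ Finset.range (m + 3), cycleSignSeq σ j = 1 := by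
    rw [prod_cycleSignSeq, h]
  have hker : ∀ a b : ℝ, ∃ x : LinearMap.ker (cycle (m + 3) σ).adjMatrix.mulVecLin,
      x.1 0 = a ∧ x.1 1 = b := by
    intro a b
    let Y := recurrenceSolution (cycleSignSeq σ) a b
    have hY : ∀ k, Y (k + 2) = -(cycleSignSeq σ k * cycleSignSeq σ (k + 1) * Y k) := fun k => rfl
    have hper : ∀ k, Y (k + (m + 3)) = Y k ∧ Y (k + 1 + (m + 3)) = Y (k + 1) := by
      intro k
      induction k with
      | zero =>
        constructor
        · rw [zero_add, hl, recurrence_even hY, ← hl, hP, one_mul]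
        · have hshift : ∏ j ∈ Finset.range (m + 3), cycleSignSeq σ (j + 1) =
              ∏ j ∈ Finset.range (m + 3), cycleSignSeq σ j := by
            rw [← mul_left_inj' (cycleSignSeq_ne_zero σ 0), ← Finset.prod_range_succ',
              Finset.prod_range_succ]
            congr 1
            simpa using cycleSignSeq_add σ 0
          rw [zero_add, add_comm 1, hl, recurrence_odd hY, ← hl, hshift, hP, one_mul]
      | succ k ih =>
        refine ⟨ih.2, ?_⟩
        rw [show k + 1 + 1 + (m + 3) = k + (m + 3) + 2 by ring, hY, ih.1, cycleSignSeq_add,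
          show k + (m + 3) + 1 = k + 1 + (m + 3) by ring, cycleSignSeq_add]
        exact (hY k).symm
    have hmod : ∀ k, Y (k % (m + 3)) = Y k := fun k =>
      Function.Periodic.map_mod_nat (f := Y) (fun k => (hper k).1) k
    refine ⟨⟨fun i => Y i.val, ?_⟩, rfl, ?_⟩
    · rw [LinearMap.mem_ker, Matrix.mulVecLin_apply, mem_ker_adjMatrix_cycle_iff]
      intro k
      rw [Fin.val_natCast, Fin.val_natCast, hmod, hmod, hY]
    · rfl
  let f : LinearMap.ker (cycle (m + 3) σ).adjMatrix.mulVecLin →ₗ[ℝ] ℝ × ℝ :=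
    { toFun := fun x => (x.1 0, x.1 1)
      map_add' := fun _ _ => rfl
      map_smul' := fun _ _ => rfl }
  have hf : Function.Surjective f := by
    rintro ⟨a, b⟩
    obtain ⟨x, h0, h1⟩ := hker a b
    exact ⟨x, Prod.ext h0 h1⟩
  have h1 := LinearMap.finrank_range_add_finrank_ker f
  rw [LinearMap.range_eq_top.2 hf, finrank_top, finrank_prod, finrank_self] at h1
  rw [nullity_eq_finrank]
  omega

end Cycle

theorem nullity_cycle_le_two_of_three_le {n : ℕ} (hn : 3 ≤ n)
    (σ : (SimpleGraph.cycleGraph n).edgeSet → ℤˣ) : (cycle n σ).nullity ≤ 2 := by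
  obtain ⟨m, rfl⟩ := Nat.exists_eq_add_of_le' hn
  exact nullity_cycle_le_two σ

theorem nullity_cycle_eq_two_iff {n : ℕ} (hn : 3 ≤ n)
    (σ : (SimpleGraph.cycleGraph n).edgeSet → ℤˣ) :
    (cycle n σ).nullity = 2 ↔
      ((cycle n σ).Balanced → n ≡ 0 [MOD 4]) ∧ (¬ (cycle n σ).Balanced → n ≡ 2 [MOD 4]) := by
  obtain ⟨m, rfl⟩ := Nat.exists_eq_add_of_le' hn
  have h1 : (cycle (m + 3) σ).nullity = 2 ↔
      ∃ l, m + 3 = 2 * l ∧ (-1) ^ l * (((∏ i, cycleSign σ i : ℤˣ) : ℤ) : ℝ) = 1 :=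
    ⟨fun h => exists_of_two_le_nullity_cycle σ h.ge, fun ⟨_, hl, h⟩ =>
      (nullity_cycle_le_two σ).antisymm (two_le_nullity_cycle σ hl h)⟩
  rw [h1, balanced_cycle_iff]
  unfold Nat.ModEq
  rcases Int.units_eq_one_or (∏ i, cycleSign σ i) with hP | hP
  · simp only [hP, Units.val_one, Int.cast_one, mul_one, not_true_eq_false, IsEmpty.forall_iff,
      and_true, forall_const]
    constructor
    · rintro ⟨l, hl, h⟩
      rw [neg_one_pow_eq_one_iff_even (by norm_num)] at h
      obtain ⟨k, rfl⟩ := h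
      omega
    · intro h
      -- Half of the length, written so that its parity is visible.
      refine ⟨2 * ((m + 3) / 4), by omega, ?_⟩
      simp [pow_mul]
  · have hne : (-1 : ℤˣ) ≠ 1 := by decide
    simp only [hP, hne, Units.val_neg, Units.val_one, Int.cast_neg, Int.cast_one, mul_neg, mul_one,
      IsEmpty.forall_iff, not_false_eq_true, true_and, forall_const]
    constructor
    · rintro ⟨l, hl, h⟩
      rcases Nat.even_or_odd' l with ⟨k, rfl | rfl⟩
      · simp [pow_mul] at h
        norm_num at h
      · omega
    · intro h
      refine ⟨2 * ((m + 3) / 4) + 1, by omega, ?_⟩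
      simp [pow_add, pow_mul]

end SignedGraph

/-! ### The degree form of `p + 2θ` and the main theorem. -/

namespace SignedGraph

open Module SimpleGraph

theorem numPendant_add_two_mul_cyclomaticNumber {V : Type*} [Fintype V] (Γ : SignedGraph V)
    [DecidableRel Γ.graph.Adj] (hpos : ∀ v, 0 < Γ.graph.degree v) :
    (Γ.numPendant : ℤ) + 2 * Γ.cyclomaticNumber =
      ((2 * Nat.card Γ.graph.ConnectedComponent + ∑ v, (Γ.graph.degree v - 2) : ℕ) : ℤ) := by
  have h1 := sum_degree_sub_two_add hpos
  have h2 : Γ.numPendant = (Finset.univ.filter fun v => Γ.graph.degree v = 1).card := by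
    rw [numPendant, ← Fintype.card_subtype, ← Nat.card_eq_fintype_card]
    simp only [degree_eq_ncard_neighborSet]
  have h3 : Nat.card Γ.graph.edgeSet = Γ.graph.edgeFinset.card := by
    rw [Nat.card_eq_fintype_card, edgeFinset_card]
  rw [cyclomaticNumber, h2, h3, Nat.card_eq_fintype_card (α := V)]
  zify at h1 ⊢
  linarith

theorem degree_pos_of_two_le_ncard_supp {V : Type*} [Finite V] {G : SimpleGraph V}
    (hG : ∀ c : G.ConnectedComponent, 2 ≤ c.supp.ncard) (v : V) [Fintype (G.neighborSet v)] :
    0 < G.degree v := by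
  obtain ⟨w, hw, hne⟩ := Set.exists_ne_of_one_lt_ncard (hG (G.connectedComponentMk v)) v
  obtain ⟨p⟩ : G.Reachable v w := (ConnectedComponent.exact hw).symm
  cases p with
  | nil => exact absurd rfl hne
  | cons h _ => exact (G.degree_pos_iff_exists_adj v).2 ⟨_, h⟩

end SignedGraph

open SignedGraph in
theorem corollary4p2 {V : Type*} [Fintype V] [DecidableEq V] (Γ : SignedGraph V)
    (hΓ : ∀ c : Γ.graph.ConnectedComponent, 2 ≤ c.supp.ncard) :
    (Γ.nullity : ℤ) = Γ.numPendant + 2 * Γ.cyclomaticNumber ↔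
      ∃ (t : ℕ) (n : Fin t → ℕ)
        (σ : ∀ i : Fin t, (SimpleGraph.cycleGraph (n i)).edgeSet → ℤˣ),
        (∀ i, 3 ≤ n i) ∧
        ∑ i, n i = Fintype.card V ∧
        Γ.Isomorphic (SignedGraph.disjUnion fun i => SignedGraph.cycle (n i) (σ i)) ∧
        ∀ i, ((SignedGraph.cycle (n i) (σ i)).Balanced → n i ≡ 0 [MOD 4]) ∧
          (¬ (SignedGraph.cycle (n i) (σ i)).Balanced → n i ≡ 2 [MOD 4]) := by
  classical
  have hpos : ∀ v, 0 < Γ.graph.degree v := fun v => degree_pos_of_two_le_ncard_supp hΓ v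
  rw [numPendant_add_two_mul_cyclomaticNumber Γ hpos, Nat.cast_inj]
  have hcard : ∀ (t : ℕ) (n : Fin t → ℕ), (∀ i, 3 ≤ n i) →
      (Γ.graph ≃g graphUnion fun i => SimpleGraph.cycleGraph (n i)) →
      Nat.card Γ.graph.ConnectedComponent = t := by
    intro t n hn φ
    have hconn : ∀ i, (SimpleGraph.cycleGraph (n i)).Connected := fun i => by
      obtain ⟨m, hm⟩ := Nat.exists_eq_add_of_le' (hn i)
      rw [hm]
      exact SimpleGraph.cycleGraph_connected
    rw [Nat.card_congr φ.connectedComponentEquiv, card_connectedComponent_graphUnion hconn,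
      Nat.card_fin]
  constructor
  · intro h
    have hdeg := SimpleGraph.degree_eq_two_of_le_finrank_ker Γ.adjMatrix_ne_zero_iff hpos
      (by rw [← h, nullity_eq_finrank])
    obtain ⟨t, n, hn, ⟨φ⟩⟩ := exists_iso_graphUnion_cycleGraph Γ.graph
      fun v => by rw [← SimpleGraph.degree_eq_ncard_neighborSet, hdeg]
    obtain ⟨σ, hσ⟩ := exists_isomorphic_disjUnion Γ _ φ
    have hσ' : Γ.Isomorphic (disjUnion fun i => cycle (n i) (σ i)) := hσ
    refine ⟨t, n, σ, hn, ?_, hσ', fun i => (nullity_cycle_eq_two_iff (hn i) (σ i)).1 ?_⟩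
    · rw [Fintype.card_congr φ.toEquiv, Fintype.card_sigma]
      simp
    · have hle : ∀ i ∈ Finset.univ, (cycle (n i) (σ i)).nullity ≤ 2 :=
        fun i _ => nullity_cycle_le_two_of_three_le (hn i) (σ i)
      -- The `t` nullities, each at most 2, add up to `2t`, so none can be smaller than 2.
      have hsum : ∑ i, (cycle (n i) (σ i)).nullity = ∑ _i : Fin t, 2 := by
        rw [← nullity_disjUnion, ← hσ'.nullity_eq, h, hcard t n hn φ]
        simp [hdeg, mul_comm]
      exact (Finset.sum_eq_sum_iff_of_le hle).1 hsum i (Finset.mem_univ i)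
  · rintro ⟨t, n, σ, hn, -, hiso, hbal⟩
    obtain ⟨φ, -⟩ := id hiso
    have hdeg : ∀ v, Γ.graph.degree v = 2 := by
      intro v
      rw [SimpleGraph.degree_eq_ncard_neighborSet, ← Nat.card_coe_set_eq,
        Nat.card_congr (φ.mapNeighborSet v), Nat.card_coe_set_eq]
      exact (ncard_neighborSet_graphUnion (fun i => SimpleGraph.cycleGraph (n i))
        (φ v).1 (φ v).2).trans
        (SimpleGraph.ncard_neighborSet_cycleGraph (hn _) _)
    rw [hiso.nullity_eq, nullity_disjUnion, hcard t n hn φ,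
      Finset.sum_congr rfl fun i _ => (nullity_cycle_eq_two_iff (hn i) (σ i)).2 (hbal i)]
    simp [hdeg, mul_comm]
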